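/- A harmonious coloring of a finite graph $G$ is a proper vertex coloring such that every pair of colors appears on at most one edge, and the harmonious chromatic number $h(G)$ is the least number of colors in a harmonious coloring of $G$. The incidence graph of the complete graph $K_n$ is the bipartite graph whose vertices are the vertices and the edges of $K_n$, a vertex $v$ of $K_n$ being adjacent to an edge $e$ of $K_n$ exactly when $v$ is an end of $e$. Theorem. There is a constant $C$ such that for every integer $n \ge 2$ the incidence graph $G$ of the complete graph $K_n$ satisfies $$\frac{3}{2}\,n \;\le\; h(G) \;\le\; \frac{5}{3}\,n + C .$$ -/

import Mathlib

namespace SimpleGraph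

/-- A proper coloring is harmonious if distinct edges receive distinct (unordered) pairs of
colors, i.e. every pair of colors appears on at most one edge. -/
def Coloring.IsHarmonious {V α : Type*} {G : SimpleGraph V} (c : G.Coloring α) : Prop :=
  ∀ e ∈ G.edgeSet, ∀ f ∈ G.edgeSet, Sym2.map c e = Sym2.map c f → e = f

/-- `G` has a harmonious coloring with `k` colors. -/
def HarmoniouslyColorable {V : Type*} (G : SimpleGraph V) (k : ℕ) : Prop :=
  ∃ c : G.Coloring (Fin k), c.IsHarmonious

/-- Every finite graph has a harmonious coloring, namely the one that gives distinct colors to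
distinct vertices; so the minimum below is attained for finite graphs. -/
theorem harmoniouslyColorable_card {V : Type*} [Fintype V] (G : SimpleGraph V) :
    G.HarmoniouslyColorable (Fintype.card V) :=
  ⟨Coloring.mk (Fintype.equivFin V) fun h he => h.ne ((Fintype.equivFin V).injective he),
    fun _ _ _ _ h => Sym2.map.injective (Fintype.equivFin V).injective h⟩

/-- The harmonious chromatic number of a finite graph: the least `k` such that the graph has a
harmonious coloring with `k` colors. -/
noncomputable def harmoniousChromaticNumber {V : Type*} (G : SimpleGraph V) : ℕ :=
  sInf {k : ℕ | G.HarmoniouslyColorable k}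

/-- The incidence (Levi) graph of a graph `G`: its vertices are the vertices and the edges of `G`,
and a vertex `v` of `G` is adjacent to an edge `e` of `G` exactly when `v` is an end of `e`;
there are no other adjacencies. -/
def incidenceGraph {V : Type*} (G : SimpleGraph V) : SimpleGraph (V ⊕ G.edgeSet) where
  Adj
    | Sum.inl v, Sum.inr e => v ∈ (e : Sym2 V)
    | Sum.inr e, Sum.inl v => v ∈ (e : Sym2 V)
    | Sum.inl _, Sum.inl _ => False
    | Sum.inr _, Sum.inr _ => False
  symm := ⟨by rintro (v | e) (w | f) h <;> exact h⟩
  loopless := ⟨by rintro (v | e) h <;> exact h⟩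

end SimpleGraph

namespace SimpleGraph

/-! Lower bound: the vertices of `K_n` get distinct colors, forming a set `S` of size `n`. The flags
(vertex, edge) whose edge color lies in `S` use distinct pairs from `S`, so they are at most half of
the `n(n-1)` flags. Each of the `k - n` other colors serves at most `2⌊n/2⌋` flags, so `k - n ≥
n/2`. Upper bound: split `6t` vertices into three cyclically ordered parts of size `2t`. Edges
inside a part reuse the vertex colors of the next part. Edges between parts form a blow-up of the
octahedron and need `4t` new colors. The total is `10t`. -/

/-- A harmonious coloring of the incidence graph of a complete graph amounts to a coloring `φ` of
the vertices and a symmetric coloring `g` of the edges such that the pairs of colors of distinct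
flags are distinct. -/
theorem harmoniouslyColorable_incidenceGraph_iff {V : Type*} {k : ℕ} :
    (completeGraph V).incidenceGraph.HarmoniouslyColorable k ↔
      ∃ (φ : V → Fin k) (g : V → V → Fin k), (∀ u v, g u v = g v u) ∧
        (∀ u v, u ≠ v → φ u ≠ g u v) ∧
        ∀ u v u' v', u ≠ v → u' ≠ v' → s(φ u, g u v) = s(φ u', g u' v') → u = u' ∧ v = v' := by
  classical
  constructor
  · rintro ⟨c, hc⟩
    refine ⟨fun u => c (Sum.inl u), fun u v =>
      -- The value on the diagonal is never used.
      if h : u ≠ v then c (Sum.inr ⟨s(u, v), h⟩) else c (Sum.inl u), ?_, ?_, ?_⟩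
    · intro u v
      by_cases h : u = v
      · subst h; rfl
      · have h' : v ≠ u := Ne.symm h
        simp only [ne_eq, h, h', not_false_eq_true, dite_true]
        congr 3
        exact Sym2.eq_swap
    · intro u v h
      simp only [ne_eq, h, not_false_eq_true, dite_true]
      apply c.valid
      exact Sym2.mem_mk_left u v
    · intro u v u' v' h h' he
      simp only [ne_eq, h, h', not_false_eq_true, dite_true] at he
      have key := hc s(Sum.inl u, Sum.inr ⟨s(u, v), h⟩) (Sym2.mem_mk_left u v)
        s(Sum.inl u', Sum.inr ⟨s(u', v'), h'⟩) (Sym2.mem_mk_left u' v') he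
      simp only [Sym2.eq_iff, Sum.inl.injEq, Sum.inr.injEq, reduceCtorEq,
        and_false, or_false] at key
      obtain ⟨rfl, h2⟩ := key
      grind
  · rintro ⟨φ, g, hs, hp, hi⟩
    let c : V ⊕ (completeGraph V).edgeSet → Fin k :=
      Sum.elim φ fun e => Sym2.lift ⟨g, hs⟩ (e : Sym2 V)
    have flag : ∀ (v : V) (e : (completeGraph V).edgeSet), v ∈ (e : Sym2 V) →
        ∃ w, ∃ h : v ≠ w, e = ⟨s(v, w), h⟩ := by
      rintro v ⟨e, he⟩ hv
      obtain ⟨w, rfl⟩ := hv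
      exact ⟨w, he, rfl⟩
    have valid : ∀ {x y}, (completeGraph V).incidenceGraph.Adj x y → c x ≠ c y := by
      rintro (v | e) (w | f) h
      · exact h.elim
      · obtain ⟨w, hw, rfl⟩ := flag v f h
        exact hp v w hw
      · obtain ⟨v, hv, rfl⟩ := flag w e h
        exact (hp w v hv).symm
      · exact h.elim
    have edge : ∀ e ∈ (completeGraph V).incidenceGraph.edgeSet, ∃ v w, ∃ h : v ≠ w,
        e = s(Sum.inl v, Sum.inr ⟨s(v, w), h⟩) := by
      intro e
      induction e with
      | _ x y =>
        rcases x with v | e <;> rcases y with w | f <;> intro h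
        · exact h.elim
        · obtain ⟨w, hw, rfl⟩ := flag v f h
          exact ⟨v, w, hw, rfl⟩
        · obtain ⟨v, hv, rfl⟩ := flag w e h
          exact ⟨w, v, hv, Sym2.eq_swap⟩
        · exact h.elim
    refine ⟨Coloring.mk c valid, ?_⟩
    intro e he f hf h
    obtain ⟨u, v, huv, rfl⟩ := edge e he
    obtain ⟨u', v', huv', rfl⟩ := edge f hf
    obtain ⟨rfl, rfl⟩ := hi u v u' v' huv huv' h
    rfl

/-- A vertex coloring with distinct colors and a compatible edge coloring on `V`, with any finite
type of colors, restricts along an injection `ι : W → V` to a harmonious coloring of the incidence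
graph of the complete graph on `W`. -/
theorem harmoniouslyColorable_incidenceGraph_of_injective {V W α : Type*} [Fintype α]
    {ι : W → V} (hι : ι.Injective) (φ : V → α) (g : V → V → α) (hφ : φ.Injective)
    (hs : ∀ u v, g u v = g v u) (hp : ∀ u v, u ≠ v → φ u ≠ g u v)
    (hg : ∀ u v w, u ≠ v → u ≠ w → g u v = g u w → v = w)
    (ho : ∀ u v u' v', u ≠ v → u' ≠ v' → φ u = g u' v' → φ u' ≠ g u v) :
    (completeGraph W).incidenceGraph.HarmoniouslyColorable (Fintype.card α) := by
  let e := Fintype.equivFin α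
  refine harmoniouslyColorable_incidenceGraph_iff.2
    ⟨fun u => e (φ (ι u)), fun u v => e (g (ι u) (ι v)), fun u v => congrArg e (hs _ _),
      fun u v h => e.injective.ne (hp _ _ (hι.ne h)), ?_⟩
  intro u v u' v' h h' he
  simp only [Sym2.eq_iff, e.injective.eq_iff] at he
  rcases he with ⟨h1, h2⟩ | ⟨h1, h2⟩
  · obtain rfl := hι (hφ h1)
    exact ⟨rfl, hι (hg _ _ _ (hι.ne h) (hι.ne h') h2)⟩
  · exact absurd h2.symm (ho _ _ _ _ (hι.ne h) (hι.ne h') h1)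

/-- A proper edge coloring of the octahedron `K_{2,2,2}` with four colors: the value at
`(i, a), (j, b)` with `i ≠ j` is the color of the edge joining vertex `a` of part `i` and
vertex `b` of part `j`. -/
def octahedronEdgeColoring (p q : ZMod 3 × ZMod 2) : ZMod 2 × ZMod 2 :=
  if p.1 = 0 ∧ q.1 = 1 then (p.2, q.2)
  else if p.1 = 1 ∧ q.1 = 0 then (q.2, p.2)
  else if p.1 = 1 ∧ q.1 = 2 then (q.2 + p.2 + 1, p.2 + 1)
  else if p.1 = 2 ∧ q.1 = 1 then (p.2 + q.2 + 1, q.2 + 1)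
  else if p.1 = 2 ∧ q.1 = 0 then (q.2 + 1, q.2 + p.2)
  else if p.1 = 0 ∧ q.1 = 2 then (p.2 + 1, p.2 + q.2)
  else (0, 0)

theorem octahedronEdgeColoring_comm : ∀ p q,
    octahedronEdgeColoring p q = octahedronEdgeColoring q p := by
  decide

theorem octahedronEdgeColoring_proper : ∀ p q r, p.1 ≠ q.1 → p.1 ≠ r.1 →
    octahedronEdgeColoring p q = octahedronEdgeColoring p r → q = r := by
  decide

/-- An edge coloring of the complete graph on three parts `ZMod 2 × ZMod t`. Edges inside part `i`
are colored by vertices of part `i + 1`; edges between parts get one of `4 * t` further colors. -/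
def tripartiteEdgeColoring {t : ℕ} (u v : (ZMod 3 × ZMod 2) × ZMod t) :
    (ZMod 3 × ZMod 2) × ZMod t ⊕ (ZMod 2 × ZMod 2) × ZMod t :=
  if u.1.1 = v.1.1 then Sum.inl ((u.1.1 + 1, u.1.2 + v.1.2), u.2 + v.2)
  else Sum.inr (octahedronEdgeColoring u.1 v.1, u.2 + v.2)

theorem tripartiteEdgeColoring_comm {t : ℕ} (u v : (ZMod 3 × ZMod 2) × ZMod t) :
    tripartiteEdgeColoring u v = tripartiteEdgeColoring v u := by
  by_cases h : u.1.1 = v.1.1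
  · rw [tripartiteEdgeColoring, tripartiteEdgeColoring, if_pos h, if_pos h.symm, h,
      add_comm u.1.2, add_comm u.2]
  · rw [tripartiteEdgeColoring, tripartiteEdgeColoring, if_neg h, if_neg (Ne.symm h),
      octahedronEdgeColoring_comm, add_comm u.2]

/-- The summand containing the color tells whether the other end lies in the part of `u`;
cancellation in the sums and properness on the octahedron then recover it. -/
theorem tripartiteEdgeColoring_proper {t : ℕ} {u v w : (ZMod 3 × ZMod 2) × ZMod t}
    (h : tripartiteEdgeColoring u v = tripartiteEdgeColoring u w) : v = w := by
  unfold tripartiteEdgeColoring at h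
  split_ifs at h with hv hw hw
  · simp only [Sum.inl.injEq, Prod.mk.injEq, add_right_inj, true_and] at h
    exact Prod.ext (Prod.ext (hv.symm.trans hw) h.1) h.2
  · simp only [Sum.inr.injEq, Prod.mk.injEq, add_right_inj] at h
    exact Prod.ext (octahedronEdgeColoring_proper _ _ _ hv hw h.1) h.2

/-- Only vertices of part `i + 1` serve as colors of edges at a vertex of part `i`. -/
theorem fst_eq_of_inl_eq_tripartiteEdgeColoring {t : ℕ} {w u v : (ZMod 3 × ZMod 2) × ZMod t}
    (h : Sum.inl w = tripartiteEdgeColoring u v) : w.1.1 = u.1.1 + 1 := by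
  unfold tripartiteEdgeColoring at h
  split_ifs at h
  rw [Sum.inl.inj h]

/-- If `n ≤ 6 * t`, the incidence graph of `K_n` has a harmonious coloring with `10 * t` colors. -/
theorem harmoniouslyColorable_incidenceGraph_completeGraph {n t : ℕ} [NeZero t]
    (hn : n ≤ 6 * t) :
    (completeGraph (Fin n)).incidenceGraph.HarmoniouslyColorable (10 * t) := by
  have hcard : Fintype.card ((ZMod 3 × ZMod 2) × ZMod t ⊕ (ZMod 2 × ZMod 2) × ZMod t) =
      10 * t := by
    simp only [Fintype.card_sum, Fintype.card_prod, ZMod.card]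
    ring
  obtain ⟨ι⟩ : Nonempty (Fin n ↪ (ZMod 3 × ZMod 2) × ZMod t) :=
    Function.Embedding.nonempty_of_card_le (by simpa [ZMod.card] using hn)
  have next : ∀ i : ZMod 3, i ≠ i + 1 := by decide
  have next₂ : ∀ i : ZMod 3, i ≠ i + 1 + 1 := by decide
  rw [← hcard]
  refine harmoniouslyColorable_incidenceGraph_of_injective ι.injective Sum.inl
    tripartiteEdgeColoring Sum.inl_injective tripartiteEdgeColoring_comm
    (fun u v _ h => next _ (fst_eq_of_inl_eq_tripartiteEdgeColoring h))
    (fun u v w _ _ h => tripartiteEdgeColoring_proper h) fun u v u' v' _ _ h h' => ?_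
  have h₁ := fst_eq_of_inl_eq_tripartiteEdgeColoring h
  have h₂ := fst_eq_of_inl_eq_tripartiteEdgeColoring h'
  -- Mutual reuse would force `i = i + 2` in `ZMod 3`.
  exact next₂ u.1.1 (by rw [← h₂, ← h₁])

/-- A finite set of ordered pairs that is closed under swapping and contains no diagonal pair has
even cardinality. -/
theorem even_card_of_swap_mem {V : Type*} (s : Finset (V × V))
    (hs : ∀ p ∈ s, p.swap ∈ s) (hd : ∀ p ∈ s, p.1 ≠ p.2) : Even s.card := by
  have h : ∑ _p ∈ s, (1 : ZMod 2) = 0 :=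
    Finset.sum_involution (fun p _ => p.swap) (fun _ _ => by decide)
      (fun p hp _ he => hd p hp (congrArg Prod.snd he)) (fun p hp => hs p hp)
      (fun p _ => p.swap_swap)
  rw [Finset.sum_const, nsmul_one] at h
  exact (ZMod.natCast_eq_zero_iff_even).1 h

/-- A harmonious coloring of the incidence graph of `K_n` has at least `3 * n / 2` colors. -/
theorem three_mul_le_of_harmoniouslyColorable_incidenceGraph {n k : ℕ} (hn : 2 ≤ n)
    (h : (completeGraph (Fin n)).incidenceGraph.HarmoniouslyColorable k) : 3 * n ≤ 2 * k := by
  classical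
  obtain ⟨φ, g, hs, hp, hi⟩ := harmoniouslyColorable_incidenceGraph_iff.1 h
  have hφ : φ.Injective := by
    intro u v huv
    by_contra hne
    -- Otherwise both flags of the edge `uv` would carry the same pair.
    exact hne (hi u v v u hne (Ne.symm hne) (by rw [huv, hs])).1
  let S : Finset (Fin k) := Finset.univ.image φ
  have hS : S.card = n := by simp [S, Finset.card_image_of_injective _ hφ]
  let D : Finset (Fin n × Fin n) := Finset.univ.offDiag
  have hD : D.card = n * n - n := by simp [D, Finset.offDiag_card]
  have hD₁ : (D.filter fun p => g p.1 p.2 ∈ S).card ≤ n.choose 2 := by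
    have hch : n.choose 2 = (S.offDiag.image Sym2.mk.uncurry).card := by
      rw [Sym2.card_image_offDiag, hS]
    rw [hch]
    apply Finset.card_le_card_of_injOn fun p => s(φ p.1, g p.1 p.2)
    · intro p hp'
      simp only [D, Finset.mem_coe, Finset.mem_filter, Finset.mem_offDiag, Finset.mem_univ,
        true_and] at hp'
      exact Finset.mem_image.2 ⟨(φ p.1, g p.1 p.2), Finset.mem_offDiag.2
        ⟨Finset.mem_image_of_mem _ (Finset.mem_univ _), hp'.2, hp _ _ hp'.1⟩, rfl⟩
    · intro p hp' q hq' he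
      simp only [D, Finset.mem_coe, Finset.mem_filter, Finset.mem_offDiag, Finset.mem_univ,
        true_and] at hp' hq'
      have := hi _ _ _ _ hp'.1 hq'.1 he
      exact Prod.ext this.1 this.2
  -- A color occurs on at most one edge at each vertex, and every edge contributes two flags.
  have hfib : ∀ y, (D.filter fun p => g p.1 p.2 = y).card ≤ 2 * (n / 2) := by
    intro y
    have hle : (D.filter fun p => g p.1 p.2 = y).card ≤ n := by
      conv_rhs => rw [← Finset.card_fin n]
      apply Finset.card_le_card_of_injOn Prod.fst
      · intro p _
        simp
      · intro p hp' q hq' he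
        simp only [D, Finset.mem_coe, Finset.mem_filter, Finset.mem_offDiag, Finset.mem_univ,
          true_and] at hp' hq'
        have := hi _ _ _ _ hp'.1 hq'.1 (by rw [hp'.2, hq'.2, he])
        exact Prod.ext this.1 this.2
    have heven : Even (D.filter fun p => g p.1 p.2 = y).card := by
      apply even_card_of_swap_mem
      · intro p hp'
        simp only [D, Finset.mem_filter, Finset.mem_offDiag, Finset.mem_univ, true_and,
          Prod.fst_swap, Prod.snd_swap] at hp' ⊢
        exact ⟨hp'.1.symm, by rw [hs, hp'.2]⟩
      · intro p hp'
        simp only [D, Finset.mem_filter, Finset.mem_offDiag, Finset.mem_univ, true_and] at hp'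
        exact hp'.1
    obtain ⟨m, hm⟩ := heven
    omega
  have hD₂ : (D.filter fun p => g p.1 p.2 ∉ S).card ≤ (k - n) * (2 * (n / 2)) := by
    have hSc : Sᶜ.card = k - n := by rw [Finset.card_compl, hS, Fintype.card_fin]
    rw [← hSc, mul_comm]
    refine Finset.card_le_mul_card_image_of_maps_to (f := fun p => g p.1 p.2) ?_ _ ?_
    · intro p hp'
      exact Finset.mem_compl.2 (Finset.mem_filter.1 hp').2
    · intro y _
      refine (Finset.card_le_card ?_).trans (hfib y)
      exact Finset.filter_subset_filter _ (Finset.filter_subset _ _)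
  have hkn : n ≤ k := by
    simpa using Fintype.card_le_of_injective φ hφ
  have hsum := Finset.card_filter_add_card_filter_not (s := D) (fun p => g p.1 p.2 ∈ S)
  have hch : n.choose 2 * 2 = n * (n - 1) := by
    rw [Nat.choose_two_right]
    exact Nat.div_mul_cancel (Nat.even_mul_pred_self n).two_dvd
  obtain ⟨j, rfl⟩ := Nat.exists_eq_add_of_le hkn
  obtain ⟨m, rfl⟩ := Nat.exists_eq_add_of_le' (show 1 ≤ n by omega)
  have hD' : D.card = (m + 1) * m := by
    rw [hD, ← Nat.mul_sub_one, Nat.add_sub_cancel]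
  rw [Nat.add_sub_cancel] at hch
  rw [Nat.add_sub_cancel_left] at hD₂
  have key : (m + 1) * m ≤ 2 * (j * (2 * ((m + 1) / 2))) := by omega
  -- Here `n = m + 1` and `k = n + j`. For odd `n` the bound `2⌊n/2⌋ = m` gives `n ≤ 2j`; for even
  -- `n`, `m ≤ 2j` improves to `n ≤ 2j` by parity.
  rcases Nat.even_or_odd' m with ⟨r, hr | hr⟩
  · have : 2 * ((m + 1) / 2) = m := by omega
    rw [this, ← mul_assoc] at key
    have := Nat.le_of_mul_le_mul_right key (by omega)
    omega
  · have : 2 * ((m + 1) / 2) = m + 1 := by omega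
    rw [this, ← mul_assoc, mul_comm] at key
    have := Nat.le_of_mul_le_mul_right key (by omega)
    omega

end SimpleGraph

theorem theorem12 :
    (∀ n : ℕ, 2 ≤ n →
      (3 / 2 : ℝ) * (n : ℝ) ≤
        ((SimpleGraph.completeGraph (Fin n)).incidenceGraph.harmoniousChromaticNumber : ℝ)) ∧
    (∃ C : ℝ, ∀ n : ℕ, 2 ≤ n →
      ((SimpleGraph.completeGraph (Fin n)).incidenceGraph.harmoniousChromaticNumber : ℝ) ≤
        (5 / 3 : ℝ) * (n : ℝ) + C) := by

  open SimpleGraph in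
  refine ⟨fun n hn => ?_, 10, fun n hn => ?_⟩
  · have h : 3 * n ≤ 2 * (completeGraph (Fin n)).incidenceGraph.harmoniousChromaticNumber := by
      classical
      exact three_mul_le_of_harmoniouslyColorable_incidenceGraph hn
        (Nat.sInf_mem (s := {k | (completeGraph (Fin n)).incidenceGraph.HarmoniouslyColorable k})
          ⟨_, harmoniouslyColorable_card _⟩)
    have h' : (3 * n : ℝ) ≤
        2 * ((completeGraph (Fin n)).incidenceGraph.harmoniousChromaticNumber : ℝ) := by
      exact_mod_cast h
    linarith
  -- Take `t = ⌈n/6⌉`, so that `6t ≤ n + 5`.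
  · have : NeZero ((n + 5) / 6) := ⟨by omega⟩
    have h : (completeGraph (Fin n)).incidenceGraph.harmoniousChromaticNumber ≤
        10 * ((n + 5) / 6) :=
      Nat.sInf_le (harmoniouslyColorable_incidenceGraph_completeGraph (by omega))
    have h' : 3 * (completeGraph (Fin n)).incidenceGraph.harmoniousChromaticNumber ≤
        5 * n + 30 := by omega
    have h'' : (3 * (completeGraph (Fin n)).incidenceGraph.harmoniousChromaticNumber : ℝ) ≤
        5 * n + 30 := by exact_mod_cast h'
    linarith
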